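/- **Theorem.** All rings are commutative with $1$. Let $R$ be a finite chain ring (a finite local ring whose ideals are totally ordered by inclusion), let $Q$ be a principal ideal ring, let $\varphi : Q \to R$ be a surjective ring morphism, and let $\varphi^* : R \to Q$ be any map with $\varphi\circ\varphi^* = \mathrm{Id}_R$, applied entrywise to tuples of matrices. Let $L, n_t, T \ge 1$ be integers. *Definitions.* The rank of an $m\times n$ matrix $M$ over a principal ideal ring is the number of nonzero entries on the diagonal $d_1 \mid d_2 \mid \cdots \mid d_{\min\{m,n\}}$ of a Smith normal form of $M$. The sum-rank distance of two $L$-tuples of $m\times n$ matrices is $\sum_{l=1}^L \mathrm{rk}(c_l - c'_l)$, and $\mathrm{d}_{SR}(\mathcal C)$ is its minimum over pairs of distinct elements of the code $\mathcal C$. For a finite subset (constellation) $\mathcal A$ of the ring, a code $\mathcal C \subseteq (\mathcal A^{m\times n})^L$ has dimension $k = \log_{|\mathcal A|^m}|\mathcal C|$ over $\mathcal A$, and it is MSRD over $\mathcal A$ if $k$ is a positive integer and $\mathrm{d}_{SR}(\mathcal C) = Ln - k + 1$. (Here the columns are the symbols.) Let $\mathcal C \subseteq (R^{n_t\times T})^L$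 and put $\mathcal A = \varphi^*(R) \subseteq Q$. 1. If $\mathcal C$ is MSRD over $R$, then $\varphi^*(\mathcal C) \subseteq (\mathcal A^{n_t\times T})^L$ is MSRD over $\mathcal A$, with ranks taken over $Q$, and it has the same dimension (over $\mathcal A$) and the same minimum sum-rank distance as $\mathcal C$ (over $R$). 2. The same holds with rows as symbols: if the code $\mathcal C^\top \subseteq (R^{T\times n_t})^L$ of blockwise transposes is MSRD over $R$, then $\varphi^*(\mathcal C)^\top$ is MSRD over $\mathcal A$, of the same dimension as $\mathcal C^\top$, and $\mathrm{d}_{SR}(\varphi^*(\mathcal C)) = \mathrm{d}_{SR}(\mathcal C)$. 3. Suppose that $\mathcal C$ or $\mathcal C^\top$ is MSRD over $R$ and that $Q \subseteq \mathbb C$ (that is, an injective ring morphism $Q \to \mathbb C$ is given). Then $\varphi^*(\mathcal C)$ is a space-time code over the constellation $\mathcal A\subseteq\mathbb C$ with optimal rate-diversity tradeoff for $L$ fading blocks. Precisely, for a code $\mathcal X \subseteq (\mathcal A^{n_t \times T})^L$ with at least two elements, let $d(\mathcal X)$ be the minimum of $\sum_{l=1}^L \mathrm{rk}_{\mathbb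 C}(x_l - y_l)$ over distinct $x,y\in\mathcal X$. Then every such $\mathcal X$ satisfies the Singleton-type bound $$\frac{1}{LT}\log_{|\mathcal A|}|\mathcal X| \;\le\; \frac{\max\{n_t,T\}\,\bigl(L\min\{n_t,T\} - d(\mathcal X) + 1\bigr)}{LT},$$ the code $\mathcal X = \varphi^*(\mathcal C)$ has at least two elements and attains equality, and $d(\varphi^*(\mathcal C)) = \mathrm{d}_{SR}(\mathcal C)$. -/

import Mathlib

namespace SumRank

noncomputable section

/-- The rectangular `m × n` diagonal matrix with diagonal `d`, of length `min m n`. -/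
def rectDiag {R : Type*} [CommRing R] {m n : ℕ} (d : Fin (min m n) → R) :
    Matrix (Fin m) (Fin n) R :=
  Matrix.of fun i j =>
    if h : (i : ℕ) = (j : ℕ) then d ⟨i, lt_min i.isLt (by rw [h]; exact j.isLt)⟩ else 0

/-- `d` is the diagonal of a Smith normal form of `A`: `A = U * Diag(d) * V` with `U`, `V`
invertible and `d₁ ∣ d₂ ∣ ⋯`. -/
def IsSmithForm {R : Type*} [CommRing R] {m n : ℕ} (A : Matrix (Fin m) (Fin n) R)
    (d : Fin (min m n) → R) : Prop :=
  (∀ i j, i ≤ j → d i ∣ d j) ∧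
    ∃ (U : (Matrix (Fin m) (Fin m) R)ˣ) (V : (Matrix (Fin n) (Fin n) R)ˣ),
      A = (U : Matrix (Fin m) (Fin m) R) * rectDiag d * (V : Matrix (Fin n) (Fin n) R)

/-- The rank of a matrix over a principal ideal ring: the number of nonzero diagonal entries of
its Smith normal form. (Over such a ring a Smith normal form exists and its diagonal is unique up
to units, so the set below has exactly one element.) -/
def smithRank {R : Type*} [CommRing R] {m n : ℕ} (A : Matrix (Fin m) (Fin n) R) : ℕ :=
  sInf {r : ℕ | ∃ d : Fin (min m n) → R, IsSmithForm A d ∧ {i | d i ≠ 0}.ncard = r}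

/-- The sum-rank weight of an `L`-tuple of `m × n` matrices. -/
def sumRankWeight {R : Type*} [CommRing R] {L m n : ℕ}
    (c : Fin L → Matrix (Fin m) (Fin n) R) : ℕ :=
  ∑ l, smithRank (c l)

/-- The sum-rank metric on `L`-tuples of `m × n` matrices. -/
def sumRankDist {R : Type*} [CommRing R] {L m n : ℕ}
    (c d : Fin L → Matrix (Fin m) (Fin n) R) : ℕ :=
  sumRankWeight (c - d)

/-- The minimum sum-rank distance of a code (linear or not). -/
def minSumRankDist {R : Type*} [CommRing R] {L m n : ℕ}
    (C : Set (Fin L → Matrix (Fin m) (Fin n) R)) : ℕ :=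
  sInf {w : ℕ | ∃ c ∈ C, ∃ d ∈ C, c ≠ d ∧ sumRankDist c d = w}

/-- All entries of all codewords of `C` lie in the alphabet (constellation) `A`. -/
def IsCodeOver {R : Type*} {L m n : ℕ} (A : Set R)
    (C : Set (Fin L → Matrix (Fin m) (Fin n) R)) : Prop :=
  ∀ c ∈ C, ∀ l i j, c l i j ∈ A

/-- The dimension `k = log_{|A| ^ m} |C|` of a code of tuples of `m × n` matrices over the
alphabet `A`. A column is one symbol; for `A` a whole finite chain ring `R` the set of columns
`R ^ m` is a free extension `S` of `R` of rank `m`, written in an `R`-basis, and `|A| ^ m = |S|`. -/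
def codeDim {R : Type*} {L m n : ℕ} (A : Set R)
    (C : Set (Fin L → Matrix (Fin m) (Fin n) R)) : ℝ :=
  Real.logb ((A.ncard : ℝ) ^ m) (C.ncard : ℝ)

/-- Maximum sum-rank distance codes in `(A ^ (m × n)) ^ L`, of total length `L * n`: the dimension
`k` is a positive integer and the minimum sum-rank distance is `L * n - k + 1`. -/
def IsMSRD {R : Type*} [CommRing R] {L m n : ℕ} (A : Set R)
    (C : Set (Fin L → Matrix (Fin m) (Fin n) R)) : Prop :=
  IsCodeOver A C ∧ ∃ k : ℕ, 0 < k ∧ codeDim A C = k ∧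
    (minSumRankDist C : ℤ) = (L : ℤ) * n - k + 1

/-- The image of a code under a map of alphabets, applied to every matrix entry. -/
def mapCode {R Q : Type*} {L m n : ℕ} (f : R → Q)
    (C : Set (Fin L → Matrix (Fin m) (Fin n) R)) : Set (Fin L → Matrix (Fin m) (Fin n) Q) :=
  (fun c l => (c l).map f) '' C

/-- The code obtained by transposing every matrix of every codeword. -/
def transposeCode {R : Type*} {L m n : ℕ}
    (C : Set (Fin L → Matrix (Fin m) (Fin n) R)) : Set (Fin L → Matrix (Fin n) (Fin m) R) :=
  (fun c l => (c l).transpose) '' C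

/-- The transmit diversity gain of a space-time code with `L` fading blocks, `nt` transmit antennas
and delay `T`: the minimum over distinct codewords of the sum over the blocks of the ranks
(over `ℂ`) of the differences. -/
def diversity {L nt T : ℕ} (X : Set (Fin L → Matrix (Fin nt) (Fin T) ℂ)) : ℕ :=
  sInf {w : ℕ | ∃ x ∈ X, ∃ y ∈ X, x ≠ y ∧ ∑ l, (x l - y l).rank = w}

/-- The symbol rate `(1 / (L T)) log_{|A|} |X|` of a code in `A ^ (nt × L T)`. -/
def symbolRate {L nt T : ℕ} (A : Set ℂ) (X : Set (Fin L → Matrix (Fin nt) (Fin T) ℂ)) : ℝ :=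
  1 / ((L : ℝ) * T) * Real.logb (A.ncard : ℝ) (X.ncard : ℝ)

/-- The Singleton-type upper bound on the symbol rate of a code of diversity `d`:
`log_{|A|} |X| ≤ max(nt, T) * (L * min(nt, T) - d + 1)`, divided by `L T`. -/
def singletonRate (L nt T : ℕ) (d : ℕ) : ℝ :=
  ((max nt T : ℕ) : ℝ) * ((L : ℝ) * ((min nt T : ℕ) : ℝ) - d + 1) / ((L : ℝ) * T)

/-- `X` is a space-time code over the constellation `A ⊆ ℂ` with optimal rate-diversity tradeoff:
every code with at least two codewords over `A` obeys the Singleton-type bound, and `X` attains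
it. -/
structure IsRateDiversityOptimal {L nt T : ℕ} (A : Set ℂ)
    (X : Set (Fin L → Matrix (Fin nt) (Fin T) ℂ)) : Prop where
  isCodeOver : IsCodeOver A X
  nontrivial : X.Nontrivial
  attains : symbolRate A X = singletonRate L nt T (diversity X)
  bound : ∀ Y : Set (Fin L → Matrix (Fin nt) (Fin T) ℂ), IsCodeOver A Y → Y.Nontrivial →
    symbolRate A Y ≤ singletonRate L nt T (diversity Y)

end

end SumRank

/-!
The whole statement reduces to two inequalities for the rank of a matrix over a principal ideal ring.

*Lower bound.* A ring morphism `φ` sends a Smith normal form of `B` to a Smith normal form of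
`φ(B)`, and can only turn nonzero diagonal entries into zeros, so `rk φ(B) ≤ rk B`
(`smithRank_map_le`). Applied to `B = φ*(c) - φ*(c')`, whose image is `c - c'`, this shows that
lifting a code along a section `φ*` does not decrease its minimum sum-rank distance. An injective
morphism to a field preserves the nonzero diagonal entries, and over a field the number of these
is the usual rank (`IsSmithForm.rank_eq`), so passing from `Q` to `ℂ` does not decrease it either.

*Upper bound.* A matrix supported on `s` columns has rank at most `s` (`smithRank_le_card_cols`).
Hence the codewords of a code of minimum distance `d` stay distinct after deleting any `d - 1`
columns, which is the Singleton bound (`IsCodeOver.ncard_le_pow`). Maximum sum-rank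
distance codes attain it, and lifting keeps the cardinality, so the lifted code attains it too
(`IsMSRD.mapCode`). The rate-diversity bound is the Singleton bound for the columns or for the rows,
whichever is stronger (`isRateDiversityOptimal_of_isMSRD`). Rows are treated by transposition.

Both inequalities rest on the existence of Smith normal forms over a principal ideal ring that may
have zero divisors (`exists_equiv_rectDiag`). Among all matrices equivalent to a given one, choose
one whose corner entry generates as large an ideal as possible. If every pair `(a, b)` has a
unimodular combination `a x + b y` that generates the ideal `(a, b)`, then that corner divides all entries
and the first row and column can be cleared. If `d = a x + b y` generates `(a, b)`, the pair
`(x, y)` is unimodular only up to the annihilator of `d`; it is corrected by multiples of an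
annihilating element, which is possible because a principal ideal ring has Krull dimension at most
one, hence stable range at most two (`exists_isCoprime_add_mul`).
-/

namespace SumRank

/-! ### Unimodular combinations in principal ideal rings -/

/-- Prime avoidance in a coset: `x + f s` can be moved out of finitely many incomparable primes, as
long as none of them contains both `x` and `f`. -/
theorem exists_add_mul_notMem_of_antichain {R : Type*} [CommRing R] {S : Set (Ideal R)}
    (hS : S.Finite) (hprime : ∀ P ∈ S, P.IsPrime)
    (hanti : ∀ P ∈ S, ∀ P' ∈ S, P ≤ P' → P = P') {x f : R}
    (h : ∀ P ∈ S, x ∈ P → f ∉ P) : ∃ s, ∀ P ∈ S, x + f * s ∉ P := by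
  classical
  lift S to Finset (Ideal R) using hS
  simp only [Finset.mem_coe] at *
  -- `s` lies in the primes that miss `x` and outside the primes that contain `x`
  obtain ⟨s, hs, hs'⟩ : ∃ s ∈ (S.filter (x ∉ ·)).inf id, ∀ P ∈ S, x ∈ P → s ∉ P := by
    by_contra! hcon
    have hsub : (((S.filter (x ∉ ·)).inf id : Ideal R) : Set R) ⊆
        ⋃ P ∈ (↑(S.filter (x ∈ ·)) : Set (Ideal R)), (P : Set R) := by
      intro s hs
      obtain ⟨P, hP, hx, hsP⟩ := hcon s hs
      simp only [Set.mem_iUnion]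
      exact ⟨P, by simp [hP, hx], hsP⟩
    obtain ⟨P, hP, hle⟩ := (Ideal.subset_union_prime (f := id) (⊥ : Ideal R) ⊥
      (fun P hP _ _ => hprime P (Finset.mem_filter.1 hP).1)).1 hsub
    rw [Finset.mem_filter] at hP
    have := hprime P hP.1
    obtain ⟨P', hP', hle'⟩ := (Ideal.IsPrime.inf_le' this).1 hle
    rw [Finset.mem_filter] at hP'
    have := hanti P' hP'.1 P hP.1 hle'
    exact hP'.2 (this ▸ hP.2)
  refine ⟨s, fun P hP hmem => ?_⟩
  have := hprime P hP
  by_cases hx : x ∈ P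
  · have hfs : f * s ∈ P := (P.add_mem_iff_right hx).1 hmem
    rcases this.mem_or_mem hfs with h1 | h1
    · exact h P hP hx h1
    · exact hs' P hP hx h1
  · have hsP : s ∈ P := (Finset.inf_le (f := id) (Finset.mem_filter.2 ⟨hP, hx⟩) : _ ≤ P) hs
    exact hx ((P.add_mem_iff_left (P.mul_mem_left f hsP)).1 hmem)

/-- A principal ideal ring has stable range at most two: if `(x, y, f)` is unimodular, then adding
multiples of `f` makes `(x, y)` unimodular. -/
theorem exists_isCoprime_add_mul {R : Type*} [CommRing R] [IsPrincipalIdealRing R] {x y f : R}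
    (h : ∀ M : Ideal R, M.IsMaximal → x ∈ M → y ∈ M → f ∉ M) :
    ∃ s t, IsCoprime (x + f * s) (y + f * t) := by
  -- keep `x + f s` out of every minimal prime not containing both `x` and `f`
  obtain ⟨s, hs⟩ := exists_add_mul_notMem_of_antichain (x := x) (f := f)
    (S := {P ∈ minimalPrimes R | x ∈ P → f ∉ P})
    ((minimalPrimes.finite_of_isNoetherianRing R).subset fun P hP => hP.1)
    (fun P hP => hP.1.1.1)
    (fun P hP P' hP' hle => le_antisymm hle (hP'.1.2 hP.1.1 hle)) (fun P hP => hP.2)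
  set z := x + f * s with hz
  -- keep `y + f t` out of the finitely many maximal ideals that are minimal over `x + f s`
  obtain ⟨t, ht⟩ := exists_add_mul_notMem_of_antichain (x := y) (f := f)
    (S := {M ∈ (Ideal.span {z}).minimalPrimes | M.IsMaximal})
    ((Ideal.finite_minimalPrimes_of_isNoetherianRing R (Ideal.span {z})).subset fun P hP => hP.1)
    (fun P hP => hP.1.1.1) (fun P hP P' hP' hle => hP.2.eq_of_le hP'.2.ne_top hle)
    (fun M hM hy hf => h M hM.2 (by
      have hzM : z ∈ M := hM.1.1.2 (Ideal.mem_span_singleton_self z)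
      exact (M.add_mem_iff_left (M.mul_mem_right s hf)).1 hzM) hy hf)
  refine ⟨s, t, ?_⟩
  rw [← Ideal.isCoprime_span_singleton_iff, Ideal.isCoprime_iff_sup_eq]
  by_contra hne
  obtain ⟨M, hM, hle⟩ := Ideal.exists_le_maximal _ hne
  have hzM : z ∈ M := hle (Ideal.mem_sup_left (Ideal.mem_span_singleton_self z))
  have hyM : y + f * t ∈ M := hle (Ideal.mem_sup_right (Ideal.mem_span_singleton_self _))
  have := hM.isPrime
  obtain ⟨p, hp, hpM⟩ := Ideal.exists_minimalPrimes_le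
    ((Ideal.span_singleton_le_iff_mem M).2 hzM)
  rcases hpM.eq_or_lt with rfl | hlt
  · exact ht p ⟨hp, hM⟩ hyM
  · -- otherwise `M` lies over a minimal prime of `R` that contains `x` and `f`, and so avoids `y`
    have := hp.1.1
    have hmin : p ∈ minimalPrimes R :=
      (Ring.krullDimLE_one_iff.1 inferInstance p this).resolve_right
        fun hp' => hlt.ne (hp'.eq_of_le hM.ne_top hpM)
    have hzp : z ∈ p := hp.1.2 (Ideal.mem_span_singleton_self z)
    have hxf : x ∈ p ∧ f ∈ p := by
      by_contra hcon
      exact hs p ⟨hmin, fun hx hf => hcon ⟨hx, hf⟩⟩ hzp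
    have hf := hpM hxf.2
    exact h M hM (hpM hxf.1) ((M.add_mem_iff_left (M.mul_mem_right t hf)).1 hyM) hf

/-- A generator of the ideal `(a, b)` is a combination of `a` and `b` with unimodular
coefficients. With zero divisors, the coefficients of an arbitrary such combination need
not be unimodular. -/
theorem exists_isCoprime_combination_dvd {R : Type*} [CommRing R] [IsPrincipalIdealRing R]
    (a b : R) : ∃ x y, IsCoprime x y ∧ a * x + b * y ∣ a ∧ a * x + b * y ∣ b := by
  obtain ⟨d, hd⟩ := (IsPrincipalIdealRing.principal (Ideal.span {a, b})).principal
  rw [Ideal.submodule_span_eq] at hd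
  obtain ⟨a', ha⟩ := Ideal.mem_span_singleton.1 (hd ▸ Ideal.subset_span (by simp) :
    a ∈ Ideal.span {d})
  obtain ⟨b', hb⟩ := Ideal.mem_span_singleton.1 (hd ▸ Ideal.subset_span (by simp) :
    b ∈ Ideal.span {d})
  obtain ⟨x, y, hxy⟩ := Ideal.mem_span_pair.1 (hd.symm ▸ Ideal.mem_span_singleton_self d)
  -- `f` annihilates `d`, so multiples of `f` may be added to the coefficients `x` and `y`
  set f := 1 - a' * x - b' * y with hf
  have hdf : d * f = 0 := by rw [hf]; linear_combination -hxy + x * ha + y * hb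
  obtain ⟨s, t, hst⟩ := exists_isCoprime_add_mul (x := x) (y := y) (f := f) (by
    intro M hM hx hy hfM
    refine hM.ne_top ((Ideal.eq_top_iff_one _).2 ?_)
    have := M.add_mem (M.add_mem hfM (M.mul_mem_left a' hx)) (M.mul_mem_left b' hy)
    rwa [show f + a' * x + b' * y = 1 by rw [hf]; ring] at this)
  have key : a * (x + f * s) + b * (y + f * t) = d := by
    linear_combination hxy + (f * s) * ha + (f * t) * hb + (a' * s + b' * t) * hdf
  exact ⟨_, _, hst, key ▸ ⟨a', ha⟩, key ▸ ⟨b', hb⟩⟩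

/-! ### Smith normal forms over principal ideal rings -/

/-- Equivalence of matrices, `A = U * B * V` with `U` and `V` invertible. -/
def MatEquiv {R : Type*} [CommRing R] {m n : ℕ} (A B : Matrix (Fin m) (Fin n) R) : Prop :=
  ∃ (U : (Matrix (Fin m) (Fin m) R)ˣ) (V : (Matrix (Fin n) (Fin n) R)ˣ),
    A = (U : Matrix (Fin m) (Fin m) R) * B * (V : Matrix (Fin n) (Fin n) R)

section

variable {R : Type*} [CommRing R] {m n : ℕ} {A B C : Matrix (Fin m) (Fin n) R}

theorem MatEquiv.refl (A : Matrix (Fin m) (Fin n) R) : MatEquiv A A := ⟨1, 1, by simp⟩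

theorem MatEquiv.trans (h : MatEquiv A B) (h' : MatEquiv B C) : MatEquiv A C := by
  obtain ⟨U, V, rfl⟩ := h
  obtain ⟨U', V', rfl⟩ := h'
  exact ⟨U * U', V' * V, by simp [Matrix.mul_assoc]⟩

theorem MatEquiv.mul_right (A : Matrix (Fin m) (Fin n) R) (V : (Matrix (Fin n) (Fin n) R)ˣ) :
    MatEquiv A (A * (V : Matrix (Fin n) (Fin n) R)) := ⟨1, V⁻¹, by simp [Matrix.mul_assoc]⟩

theorem isUnit_transpose {n : ℕ} (U : (Matrix (Fin n) (Fin n) R)ˣ) :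
    IsUnit (U : Matrix (Fin n) (Fin n) R).transpose := by
  rw [Matrix.isUnit_iff_isUnit_det, Matrix.det_transpose, ← Matrix.isUnit_iff_isUnit_det]
  exact U.isUnit

theorem MatEquiv.transpose (h : MatEquiv A B) : MatEquiv A.transpose B.transpose := by
  obtain ⟨U, V, rfl⟩ := h
  exact ⟨(isUnit_transpose V).unit, (isUnit_transpose U).unit, by
    simp [Matrix.transpose_mul, Matrix.mul_assoc]⟩

/-- A unimodular pair `(x, y)` is a column of an invertible `2 × 2` matrix; hence it gives an
invertible column operation on columns `0` and `j + 1`. -/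
theorem exists_unit_col_combination {x y : R} (h : IsCoprime x y) (j : Fin n) :
    ∃ V : (Matrix (Fin (n + 1)) (Fin (n + 1)) R)ˣ, ∀ {m : ℕ}
      (B : Matrix (Fin m) (Fin (n + 1)) R) (i : Fin m),
      (B * (V : Matrix (Fin (n + 1)) (Fin (n + 1)) R)) i 0 = B i 0 * x + B i j.succ * y := by
  obtain ⟨u, v, huv⟩ := h
  let e : Fin 2 → Fin (n + 1) := ![0, j.succ]
  have he : Function.Injective e := by
    intro a b; fin_cases a <;> fin_cases b <;> simp [e, Fin.succ_ne_zero, (Fin.succ_ne_zero _).symm]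
  -- `W` includes the coordinate plane of the indices `0` and `j + 1`
  let W : Matrix (Fin (n + 1)) (Fin 2) R := Matrix.of fun i k => if i = e k then 1 else 0
  have hW : W.transpose * W = 1 := by
    ext a b
    simp [W, Matrix.mul_apply, Matrix.one_apply, he.eq_iff, @eq_comm _ a b]
  -- `E M` acts as `M` on that plane and as the identity on the other coordinates
  let E : Matrix (Fin 2) (Fin 2) R → Matrix (Fin (n + 1)) (Fin (n + 1)) R :=
    fun M => 1 + W * (M - 1) * W.transpose
  have hE : ∀ M N, M * N = 1 → E M * E N = 1 := by
    intro M N hMN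
    have h1 : W * (M - 1) * W.transpose * (W * (N - 1) * W.transpose) =
        W * ((M - 1) * (N - 1)) * W.transpose := by
      rw [show W * (M - 1) * W.transpose * (W * (N - 1) * W.transpose) =
        W * (M - 1) * (W.transpose * W) * (N - 1) * W.transpose by simp only [Matrix.mul_assoc], hW]
      simp only [Matrix.mul_assoc, Matrix.one_mul]
    have h2 : (M - 1) * (N - 1) = -(M - 1) - (N - 1) := by
      rw [sub_mul, mul_sub, hMN]; simp only [mul_one, one_mul]; abel
    calc E M * E N = 1 + W * (M - 1) * W.transpose + W * (N - 1) * W.transpose +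
          W * (M - 1) * W.transpose * (W * (N - 1) * W.transpose) := by
          simp only [E, mul_add, add_mul, mul_one, one_mul]; abel
      _ = 1 := by
          rw [h1, h2, Matrix.mul_sub W (-(M - 1)), Matrix.mul_neg, Matrix.sub_mul _ (W * (N - 1)),
            Matrix.neg_mul]
          abel
  let M : Matrix (Fin 2) (Fin 2) R := !![x, -v; y, u]
  let N : Matrix (Fin 2) (Fin 2) R := !![u, v; -y, x]
  have hMN : M * N = 1 := by
    rw [Matrix.one_fin_two, Matrix.mul_fin_two]
    have h1 : x * u + -v * -y = 1 := by linear_combination huv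
    have h2 : x * v + -v * x = 0 := by ring
    have h3 : y * u + u * -y = 0 := by ring
    have h4 : y * v + u * x = 1 := by linear_combination huv
    rw [h1, h2, h3, h4]
  have hNM : N * M = 1 := mul_eq_one_comm.1 hMN
  refine ⟨⟨E M, E N, hE _ _ hMN, hE _ _ hNM⟩, fun B i => ?_⟩
  have hBW : B * W = B.submatrix id e := by
    ext a b; simp [W, Matrix.mul_apply]
  have hWt : ∀ X : Matrix (Fin _) (Fin 2) R, (X * W.transpose) i 0 = X i 0 := by
    intro X
    have h0 : W.transpose 0 0 = 1 := by simp [W, e]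
    have h1 : W.transpose 1 0 = 0 := by simp [W, e, (Fin.succ_ne_zero j).symm]
    rw [Matrix.mul_apply, Fin.sum_univ_two, h0, h1, mul_one, mul_zero, add_zero]
  simp only [E, Matrix.mul_add, ← Matrix.mul_assoc, hBW, Matrix.add_apply, hWt]
  rw [Matrix.mul_sub, Matrix.mul_one, Matrix.sub_apply, Matrix.mul_apply, Fin.sum_univ_two]
  simp [e, M]

/-- No matrix equivalent to `B` has a `(0, 0)` entry that properly divides that of `B`. -/
def IsCornerMinimal (B : Matrix (Fin (m + 1)) (Fin (n + 1)) R) : Prop :=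
  ∀ B', MatEquiv B B' → B' 0 0 ∣ B 0 0 → B 0 0 ∣ B' 0 0

theorem IsCornerMinimal.transpose {B : Matrix (Fin (m + 1)) (Fin (n + 1)) R}
    (h : IsCornerMinimal B) : IsCornerMinimal B.transpose :=
  fun B' hB' hd => h B'.transpose (by simpa using hB'.transpose) hd

theorem IsCornerMinimal.of_equiv {B B' : Matrix (Fin (m + 1)) (Fin (n + 1)) R}
    (h : IsCornerMinimal B) (hB : MatEquiv B B') (h0 : B' 0 0 = B 0 0) : IsCornerMinimal B' :=
  fun B'' hB'' hd => h0 ▸ h B'' (hB.trans hB'') (h0 ▸ hd)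

theorem exists_equiv_isCornerMinimal [IsNoetherianRing R]
    (A : Matrix (Fin (m + 1)) (Fin (n + 1)) R) : ∃ B, MatEquiv A B ∧ IsCornerMinimal B := by
  obtain ⟨I, ⟨B, hB, rfl⟩, hmax⟩ := set_has_maximal_iff_noetherian.2 ‹IsNoetherianRing R›
    {I : Ideal R | ∃ B, MatEquiv A B ∧ I = Ideal.span {B 0 0}} ⟨_, A, .refl A, rfl⟩
  refine ⟨B, hB, fun B' hB' hd => ?_⟩
  by_contra hnd
  refine hmax _ ⟨B', hB.trans hB', rfl⟩ (lt_of_le_not_ge ?_ ?_)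
  · exact Ideal.span_singleton_le_span_singleton.2 hd
  · exact fun hle => hnd (Ideal.span_singleton_le_span_singleton.1 hle)

variable [IsPrincipalIdealRing R]

theorem IsCornerMinimal.dvd_row {B : Matrix (Fin (m + 1)) (Fin (n + 1)) R}
    (h : IsCornerMinimal B) (j : Fin (n + 1)) : B 0 0 ∣ B 0 j := by
  cases j using Fin.cases with
  | zero => exact dvd_rfl
  | succ j =>
    obtain ⟨x, y, hxy, ha, hb⟩ := exists_isCoprime_combination_dvd (B 0 0) (B 0 j.succ)
    obtain ⟨V, hV⟩ := exists_unit_col_combination hxy j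
    have := h _ (.mul_right B V) (by rw [hV]; exact ha)
    rw [hV] at this
    exact this.trans hb

theorem IsCornerMinimal.dvd {B : Matrix (Fin (m + 1)) (Fin (n + 1)) R}
    (h : IsCornerMinimal B) (i : Fin (m + 1)) (j : Fin (n + 1)) : B 0 0 ∣ B i j := by
  cases j using Fin.cases with
  | zero => exact h.transpose.dvd_row i
  | succ j =>
    obtain ⟨t, ht⟩ := h.dvd_row j.succ
    -- replacing column `0` by its `(1 - t)`-fold plus column `j + 1` keeps the corner entry, and
    -- brings the entry `B i (j + 1)` into the first column
    obtain ⟨V, hV⟩ := exists_unit_col_combination (x := 1 - t) (y := 1) isCoprime_one_right j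
    have h' := h.of_equiv (.mul_right B V) (by rw [hV, ht]; ring)
    have h2 := h'.transpose.dvd_row i
    simp only [Matrix.transpose_apply, hV] at h2
    rw [show B 0 0 * (1 - t) + B 0 j.succ * 1 = B 0 0 by rw [ht]; ring, mul_one] at h2
    exact (dvd_add_right ((h.transpose.dvd_row i).mul_right _)).1 h2

end

/-- The block diagonal matrix with blocks `a` (of size `1 × 1`) and `A`. -/
def bordered {R : Type*} [CommRing R] {m n : ℕ} (a : R) (A : Matrix (Fin m) (Fin n) R) :
    Matrix (Fin (m + 1)) (Fin (n + 1)) R :=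
  Matrix.of (Fin.cons (Fin.cons a 0) fun i => Fin.cons 0 (A i))

section

variable {R : Type*} [CommRing R] {m n k : ℕ}

theorem bordered_mul (a b : R) (A : Matrix (Fin m) (Fin n) R) (B : Matrix (Fin n) (Fin k) R) :
    bordered a A * bordered b B = bordered (a * b) (A * B) := by
  ext i j
  cases i using Fin.cases <;> cases j using Fin.cases <;>
    simp [bordered, Matrix.mul_apply, Fin.sum_univ_succ]

theorem bordered_one : bordered (1 : R) (1 : Matrix (Fin m) (Fin m) R) = 1 := by
  ext i j
  cases i using Fin.cases <;> cases j using Fin.cases <;>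
    simp [bordered, Matrix.one_apply, Fin.succ_ne_zero, (Fin.succ_ne_zero _).symm]

theorem MatEquiv.bordered {A B : Matrix (Fin m) (Fin n) R} (h : MatEquiv A B) (a : R) :
    MatEquiv (bordered a A) (bordered a B) := by
  obtain ⟨U, V, rfl⟩ := h
  refine ⟨⟨SumRank.bordered 1 U, SumRank.bordered 1 ↑U⁻¹, ?_, ?_⟩,
    ⟨SumRank.bordered 1 V, SumRank.bordered 1 ↑V⁻¹, ?_, ?_⟩, ?_⟩ <;>
  simp [bordered_mul, bordered_one]

/-- A matrix all of whose first row and column is divisible by the corner entry can be cleared to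
block diagonal form. -/
theorem exists_equiv_bordered {B : Matrix (Fin (m + 1)) (Fin (n + 1)) R}
    (h : ∀ i j, B 0 0 ∣ B i j) :
    ∃ B' : Matrix (Fin m) (Fin n) R, (∀ i j, B 0 0 ∣ B' i j) ∧ MatEquiv B (bordered (B 0 0) B') := by
  choose q hq using h
  let col : R → Matrix (Fin (m + 1)) (Fin (m + 1)) R := fun s =>
    Matrix.of (Fin.cons (Fin.cons 1 0) fun i => Fin.cons (s * q i.succ 0) ((1 : Matrix _ _ R) i))
  let row : R → Matrix (Fin (n + 1)) (Fin (n + 1)) R := fun s =>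
    Matrix.of (Fin.cons (Fin.cons 1 fun j => s * q 0 j.succ) fun i =>
      Fin.cons 0 ((1 : Matrix _ _ R) i))
  have hcol : ∀ s, col s * col (-s) = 1 := by
    intro s
    ext i j
    cases i using Fin.cases <;> cases j using Fin.cases <;>
      simp [col, Matrix.mul_apply, Fin.sum_univ_succ, Matrix.one_apply, Fin.succ_ne_zero,
        (Fin.succ_ne_zero _).symm]
  have hrow : ∀ s, row s * row (-s) = 1 := by
    intro s
    ext i j
    cases i using Fin.cases <;> cases j using Fin.cases <;>
      simp [row, Matrix.mul_apply, Fin.sum_univ_succ, Matrix.one_apply, Fin.succ_ne_zero,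
        (Fin.succ_ne_zero _).symm]
  refine ⟨Matrix.of fun i j => B i.succ j.succ - B i.succ 0 * q 0 j.succ, fun i j => ?_,
    ⟨col 1, col (-1), hcol 1, by simpa using hcol (-1)⟩,
    ⟨row 1, row (-1), hrow 1, by simpa using hrow (-1)⟩, ?_⟩
  · exact dvd_sub ⟨_, hq _ _⟩ (Dvd.dvd.mul_right ⟨_, hq _ _⟩ _)
  · ext i j
    cases i using Fin.cases <;> cases j using Fin.cases <;>
      simp [row, col, bordered, Matrix.mul_apply, Fin.sum_univ_succ, Matrix.one_apply]
    · exact hq _ _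
    · rw [mul_comm]; exact hq _ _
    · rw [hq (Fin.succ _) 0]; ring

theorem rectDiag_apply (d : ℕ → R) (i : Fin m) (j : Fin n) :
    rectDiag (fun k : Fin (min m n) => d k) i j = if (i : ℕ) = j then d i else 0 := by
  simp [rectDiag]

theorem bordered_rectDiag (a : R) (d : ℕ → R) :
    bordered a (rectDiag fun k : Fin (min m n) => d k) =
      rectDiag fun k : Fin (min (m + 1) (n + 1)) => if (k : ℕ) = 0 then a else d (k - 1) := by
  ext i j
  refine Eq.trans ?_ (rectDiag_apply (fun k => if k = 0 then a else d (k - 1)) i j).symm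
  cases i using Fin.cases <;> cases j using Fin.cases <;> simp [bordered, rectDiag_apply]

theorem MatEquiv.dvd {A B : Matrix (Fin m) (Fin n) R} (h : MatEquiv A B) {a : R}
    (ha : ∀ i j, a ∣ A i j) (i : Fin m) (j : Fin n) : a ∣ B i j := by
  obtain ⟨U, V, rfl⟩ := h
  set A := (U : Matrix (Fin m) (Fin m) R) * B * (V : Matrix (Fin n) (Fin n) R) with hA
  have hB : B = (↑U⁻¹ : Matrix (Fin m) (Fin m) R) * A * (↑V⁻¹ : Matrix (Fin n) (Fin n) R) := by
    simp [hA, Matrix.mul_assoc]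
  rw [hB, Matrix.mul_apply]
  refine Finset.dvd_sum fun k _ => Dvd.dvd.mul_right ?_ _
  rw [Matrix.mul_apply]
  exact Finset.dvd_sum fun l _ => Dvd.dvd.mul_left (ha _ _) _

/-- Every matrix over a principal ideal ring, possibly with zero divisors, has a Smith normal form.
The diagonal is extended by zeros to a sequence `ℕ → R`, so that its index type does not depend on
the size of the matrix. -/
theorem exists_equiv_rectDiag [IsPrincipalIdealRing R] (A : Matrix (Fin m) (Fin n) R) :
    ∃ d : ℕ → R, (∀ i j, i ≤ j → d i ∣ d j) ∧ (∀ i, min m n ≤ i → d i = 0) ∧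
      MatEquiv A (rectDiag fun k : Fin (min m n) => d k) := by
  induction m generalizing n with
  | zero => exact ⟨0, by simp, by simp, 1, 1, by ext i; exact i.elim0⟩
  | succ m ih =>
    cases n with
    | zero => exact ⟨0, by simp, by simp, 1, 1, by ext i j; exact j.elim0⟩
    | succ n =>
      obtain ⟨B, hAB, hB⟩ := exists_equiv_isCornerMinimal A
      obtain ⟨B', hdvd, hBB'⟩ := exists_equiv_bordered hB.dvd
      obtain ⟨d, hd, hd0, hB'⟩ := ih B'
      have hdiv : ∀ k, B 0 0 ∣ d k := by
        intro k
        by_cases hk : k < min m n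
        · have := hB'.dvd hdvd ⟨k, hk.trans_le (min_le_left _ _)⟩ ⟨k, hk.trans_le (min_le_right _ _)⟩
          simpa [rectDiag_apply] using this
        · rw [hd0 k (not_lt.1 hk)]; exact dvd_zero _
      refine ⟨fun k => if k = 0 then B 0 0 else d (k - 1), ?_, ?_, ?_⟩
      · rintro (_ | i) (_ | j) hij
        · exact dvd_rfl
        · simpa using hdiv j
        · simp at hij
        · simpa using hd i j (by omega)
      · rintro (_ | i) hi
        · simp at hi
        · simpa using hd0 i (by omega)
      · rw [← bordered_rectDiag]
        exact hAB.trans (hBB'.trans (hB'.bordered _))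

end

/-! ### The rank over a principal ideal ring -/

section

variable {R S : Type*} [CommRing R] [CommRing S] {L m n : ℕ}

theorem IsSmithForm.map {A : Matrix (Fin m) (Fin n) R} {d : Fin (min m n) → R}
    (h : IsSmithForm A d) (f : R →+* S) : IsSmithForm (A.map f) (f ∘ d) := by
  obtain ⟨hd, U, V, rfl⟩ := h
  refine ⟨fun i j hij => map_dvd f (hd i j hij), Units.map (f.mapMatrix : _ →+* _).toMonoidHom U,
    Units.map (f.mapMatrix : _ →+* _).toMonoidHom V, ?_⟩
  have hD : (rectDiag d).map f = rectDiag (f ∘ d) := by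
    ext i j
    simp only [rectDiag, Matrix.map_apply, Matrix.of_apply]
    split_ifs <;> simp
  simp [Matrix.map_mul, hD]

theorem IsSmithForm.transpose {A : Matrix (Fin m) (Fin n) R} {d : Fin (min m n) → R}
    (h : IsSmithForm A d) : IsSmithForm A.transpose (d ∘ Fin.cast (min_comm n m)) := by
  have hD : (rectDiag d).transpose = rectDiag (d ∘ Fin.cast (min_comm n m)) := by
    ext i j
    simp only [rectDiag, Matrix.transpose_apply, Matrix.of_apply, Function.comp_apply]
    by_cases hij : (i : ℕ) = j
    · simp [hij]
    · simp [hij, Ne.symm hij]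
  refine ⟨fun i j hij => h.1 _ _ (by simpa using hij), ?_⟩
  rw [← hD]
  exact MatEquiv.transpose h.2

theorem smithRank_le {A : Matrix (Fin m) (Fin n) R} {d : Fin (min m n) → R}
    (h : IsSmithForm A d) : smithRank A ≤ {i | d i ≠ 0}.ncard := Nat.sInf_le ⟨d, h, rfl⟩

/-- The infimum defining the rank is attained, because Smith normal forms exist. -/
theorem exists_isSmithForm_ncard_eq [IsPrincipalIdealRing R] (A : Matrix (Fin m) (Fin n) R) :
    ∃ d, IsSmithForm A d ∧ {i | d i ≠ 0}.ncard = smithRank A := by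
  obtain ⟨d, hd, -, h⟩ := exists_equiv_rectDiag A
  exact Nat.sInf_mem (s := {r : ℕ | ∃ d : Fin (min m n) → R, IsSmithForm A d ∧
    {i | d i ≠ 0}.ncard = r}) ⟨_, fun k => d k, ⟨fun i j hij => hd i j hij, h⟩, rfl⟩

/-- Ring morphisms do not increase the rank, since they send Smith normal forms to Smith normal
forms. -/
theorem smithRank_map_le [IsPrincipalIdealRing R] (A : Matrix (Fin m) (Fin n) R) (f : R →+* S) :
    smithRank (A.map f) ≤ smithRank A := by
  obtain ⟨d, hd, hr⟩ := exists_isSmithForm_ncard_eq A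
  rw [← hr]
  refine (smithRank_le (hd.map f)).trans (Set.ncard_le_ncard fun i hi h0 => hi ?_)
  simp [h0]

theorem smithRank_transpose_le [IsPrincipalIdealRing R] (A : Matrix (Fin m) (Fin n) R) :
    smithRank A.transpose ≤ smithRank A := by
  obtain ⟨d, hd, hr⟩ := exists_isSmithForm_ncard_eq A
  rw [← hr]
  exact (smithRank_le hd.transpose).trans
    (Set.ncard_le_ncard_of_injOn (Fin.cast (min_comm n m)) (fun i hi => hi)
      (Fin.cast_injective _).injOn)

theorem smithRank_transpose [IsPrincipalIdealRing R] (A : Matrix (Fin m) (Fin n) R) :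
    smithRank A.transpose = smithRank A :=
  (smithRank_transpose_le A).antisymm (by simpa using smithRank_transpose_le A.transpose)

theorem eq_zero_of_smithRank_eq_zero [IsPrincipalIdealRing R] {A : Matrix (Fin m) (Fin n) R}
    (h : smithRank A = 0) : A = 0 := by
  obtain ⟨d, ⟨-, U, V, rfl⟩, hr⟩ := exists_isSmithForm_ncard_eq A
  rw [h, Set.ncard_eq_zero] at hr
  have hd : ∀ i, d i = 0 := fun i => by_contra fun hi => (hr ▸ hi : i ∈ (∅ : Set _))
  have : rectDiag d = 0 := by
    ext i j
    simp [rectDiag, hd]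
  simp [this]

/-- The rank is at most the number of nonzero columns: a Smith normal form of the submatrix on the
columns in `s` extends by zeros to one of `A`. -/
theorem smithRank_le_card_cols [IsPrincipalIdealRing R] {A : Matrix (Fin m) (Fin n) R}
    (s : Finset (Fin n)) (h : ∀ i, ∀ j ∉ s, A i j = 0) : smithRank A ≤ s.card := by
  classical
  have hcard : s.card + Fintype.card {j // j ∉ s} = n := by
    have := card_finset_fin_le s
    simp only [Fintype.card_subtype_compl, Fintype.card_fin, Fintype.card_coe]
    omega
  -- `e` lists the columns in `s` first, `e₀` is the standard listing
  let e : Fin s.card ⊕ Fin (Fintype.card {j // j ∉ s}) ≃ Fin n :=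
    (Equiv.sumCongr s.equivFin.symm (Fintype.equivFin _).symm).trans (Equiv.sumCompl (· ∈ s))
  let e₀ : Fin s.card ⊕ Fin (Fintype.card {j // j ∉ s}) ≃ Fin n :=
    finSumFinEquiv.trans (finCongr hcard)
  let A' : Matrix (Fin m) (Fin s.card) R := A.submatrix id (e ∘ Sum.inl)
  obtain ⟨d, hd, hd0, U, V, hUV⟩ := exists_equiv_rectDiag A'
  have hA : A = (Matrix.fromCols A' 0).submatrix id e.symm := by
    ext i j
    obtain ⟨k, rfl⟩ := e.surjective j
    cases k with
    | inl k => simp [A']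
    | inr k =>
      have : e (Sum.inr k) ∉ s := ((Fintype.equivFin {j // j ∉ s}).symm k).2
      simp [h _ _ this]
  have hD : rectDiag (fun k : Fin (min m n) => d k) =
      (Matrix.fromCols (rectDiag fun k : Fin (min m s.card) => d k) 0).submatrix id e₀.symm := by
    ext i j
    obtain ⟨k, rfl⟩ := e₀.surjective j
    rw [rectDiag_apply]
    cases k with
    | inl k => simp [e₀, rectDiag_apply]
    | inr k =>
      simp only [e₀, Equiv.trans_apply, Matrix.submatrix_apply, Equiv.symm_trans_apply]
      simp only [finSumFinEquiv_apply_right, finCongr_apply, Fin.val_cast, Fin.val_natAdd]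
      simp
      intro hi
      exact hd0 _ (by omega)
  let W : (Matrix (Fin n) (Fin n) R)ˣ :=
    ⟨(Matrix.fromBlocks (V : Matrix _ _ R) 0 0 1).submatrix e₀.symm e.symm,
     (Matrix.fromBlocks (↑V⁻¹ : Matrix _ _ R) 0 0 1).submatrix e.symm e₀.symm,
     by simp [Matrix.submatrix_mul_equiv, Matrix.fromBlocks_multiply],
     by simp [Matrix.submatrix_mul_equiv, Matrix.fromBlocks_multiply]⟩
  have hform : IsSmithForm A fun k => d k := by
    refine ⟨fun i j hij => hd i j hij, U, W, ?_⟩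
    have hmul : ∀ (X : Matrix (Fin m) (Fin s.card ⊕ Fin (Fintype.card {j // j ∉ s})) R),
        (U : Matrix (Fin m) (Fin m) R) * X.submatrix id e₀.symm =
          ((U : Matrix (Fin m) (Fin m) R) * X).submatrix id e₀.symm := fun X => rfl
    rw [hD, hmul, Matrix.submatrix_mul_equiv, Matrix.mul_fromCols, Matrix.mul_zero,
      Matrix.fromCols_mul_fromBlocks]
    simpa [← hUV] using hA
  refine (smithRank_le hform).trans ?_
  rw [← Finset.card_range s.card, ← Set.ncard_coe_finset]
  refine Set.ncard_le_ncard_of_injOn (fun i => (i : ℕ)) (fun i hi => ?_) Fin.val_injective.injOn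
  rw [Finset.mem_coe, Finset.mem_range]
  by_contra hlt
  exact hi (hd0 _ (by omega))

theorem sumRankWeight_le_card_cols [IsPrincipalIdealRing R] {c : Fin L → Matrix (Fin m) (Fin n) R}
    (s : Finset (Fin L × Fin n)) (h : ∀ l i j, (l, j) ∉ s → c l i j = 0) :
    sumRankWeight c ≤ s.card := by
  classical
  have hs : s.card = ∑ l, (Finset.univ.filter fun j => (l, j) ∈ s).card := by
    simp only [Finset.card_filter, ← Fintype.sum_prod_type' fun l j => if (l, j) ∈ s then 1 else 0]
    simp
  rw [hs]
  exact Finset.sum_le_sum fun l _ => smithRank_le_card_cols _ fun i j hj => h l i j (by simpa using hj)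

end

/-! ### The rank over a field -/

section

variable {K : Type*} [Field K] {m n : ℕ}

theorem IsSmithForm.rank_eq {A : Matrix (Fin m) (Fin n) K} {d : Fin (min m n) → K}
    (h : IsSmithForm A d) : A.rank = {i | d i ≠ 0}.ncard := by
  classical
  obtain ⟨-, U, V, rfl⟩ := h
  rw [Matrix.rank_mul_eq_left_of_isUnit_det _ _ ((Matrix.isUnit_iff_isUnit_det _).1 V.isUnit),
    Matrix.rank_mul_eq_right_of_isUnit_det _ _ ((Matrix.isUnit_iff_isUnit_det _).1 U.isUnit)]
  -- `rectDiag d` and the square diagonal matrix `w` factor through each other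
  let w : Fin m → K := fun i => if hi : (i : ℕ) < n then d ⟨i, lt_min i.2 hi⟩ else 0
  have h1 : rectDiag d = Matrix.diagonal w * (rectDiag 1 : Matrix (Fin m) (Fin n) K) := by
    ext i j
    rw [Matrix.diagonal_mul]
    by_cases hij : (i : ℕ) = j
    · simp [rectDiag, w, hij]
    · simp [rectDiag, hij]
  have h2 : Matrix.diagonal w = rectDiag d * (rectDiag 1 : Matrix (Fin n) (Fin m) K) := by
    ext i j
    rw [Matrix.mul_apply]
    by_cases hi : (i : ℕ) < n
    · rw [Finset.sum_eq_single ⟨i, hi⟩]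
      · by_cases hij : i = j
        · subst hij; simp [rectDiag, w, hi]
        · have : (i : ℕ) ≠ j := fun h => hij (Fin.ext h)
          simp [rectDiag, hij, this]
      · intro k _ hk
        have : (i : ℕ) ≠ k := fun h => hk (Fin.ext h.symm)
        simp [rectDiag, this]
      · simp
    · rw [Finset.sum_eq_zero]
      · by_cases hij : i = j
        · subst hij; simp [w, hi]
        · simp [hij]
      · intro k _
        have : (i : ℕ) ≠ k := by omega
        simp [rectDiag, this]
  have hrank : (rectDiag d).rank = (Matrix.diagonal w).rank :=
    le_antisymm (h1 ▸ Matrix.rank_mul_le_left _ _) (by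
      conv_lhs => rw [h2]
      exact Matrix.rank_mul_le_left _ _)
  rw [hrank, Matrix.rank_diagonal, ← Nat.card_eq_fintype_card]
  refine Nat.card_congr ⟨fun i => ⟨⟨i.1, lt_min i.1.2 ?_⟩, ?_⟩,
    fun i => ⟨⟨i.1, i.1.2.trans_le (min_le_left _ _)⟩, ?_⟩, fun _ => rfl, fun _ => rfl⟩
  · by_contra hi; exact i.2 (by simp [w, hi])
  · have := i.2
    simp only [w] at this
    split_ifs at this with hi
    · exact this
    · exact absurd rfl this
  · have hi : (i.1 : ℕ) < n := i.1.2.trans_le (min_le_right _ _)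
    have h0 : d i.1 ≠ 0 := i.2
    simpa [w, hi] using h0

theorem smithRank_eq_rank (A : Matrix (Fin m) (Fin n) K) : smithRank A = A.rank := by
  obtain ⟨d, hd, hr⟩ := exists_isSmithForm_ncard_eq A
  rw [← hr, hd.rank_eq]

theorem smithRank_le_smithRank_map {R : Type*} [CommRing R] [IsPrincipalIdealRing R]
    (A : Matrix (Fin m) (Fin n) R) {f : R →+* K} (hf : Function.Injective f) :
    smithRank A ≤ smithRank (A.map f) := by
  obtain ⟨d, hd, -⟩ := exists_isSmithForm_ncard_eq A
  rw [smithRank_eq_rank, (hd.map f).rank_eq]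
  simpa [map_eq_zero_iff f hf] using smithRank_le hd

end

/-! ### The Singleton bound -/

section

variable {R : Type*} {L m n : ℕ} {A : Set R}
  {C : Set (Fin L → Matrix (Fin m) (Fin n) R)}

theorem IsCodeOver.one_lt_ncard (hA : A.Finite) (hCA : IsCodeOver A C) (hC : C.Nontrivial) :
    1 < A.ncard := by
  obtain ⟨c, hc, d, hd, hcd⟩ := hC
  rw [Set.one_lt_ncard_iff hA]
  by_contra! hcon
  exact hcd (funext fun l => Matrix.ext fun i j =>
    hcon _ _ (hCA c hc l i j) (hCA d hd l i j))

theorem IsCodeOver.finite (hA : A.Finite) (hCA : IsCodeOver A C) : C.Finite := by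
  have : {c : Fin L → Fin m → Fin n → R | ∀ l i j, c l i j ∈ A}.Finite :=
    Set.Finite.pi' fun _ => Set.Finite.pi' fun _ => Set.Finite.pi' fun _ => hA
  exact this.subset hCA

theorem transposeCode_injective :
    Function.Injective fun (c : Fin L → Matrix (Fin m) (Fin n) R) l => (c l).transpose :=
  fun _ _ h => funext fun l => Matrix.transpose_injective (congrFun h l)

theorem ncard_transposeCode : (transposeCode C).ncard = C.ncard :=
  Set.ncard_image_of_injective _ transposeCode_injective

theorem IsCodeOver.transposeCode (hCA : IsCodeOver A C) : IsCodeOver A (transposeCode C) := by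
  rintro _ ⟨c, hc, rfl⟩ l i j
  exact hCA c hc l j i

theorem nontrivial_transposeCode : (transposeCode C).Nontrivial ↔ C.Nontrivial :=
  Set.image_nontrivial transposeCode_injective

/-- `|C| = |A| ^ (m k)` in logarithmic form, for a code of dimension `k`. -/
theorem logb_ncard_eq (hm : 0 < m) {k : ℝ} (h : codeDim A C = k) :
    Real.logb A.ncard C.ncard = m * k := by
  have hm' : (m : ℝ) ≠ 0 := by exact_mod_cast hm.ne'
  rw [← h, codeDim, Real.logb, Real.logb, Real.log_pow]
  field_simp

theorem nontrivial_of_codeDim_pos (h : 0 < codeDim A C) : C.Nontrivial := by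
  have h1 : 1 < C.ncard := by
    by_contra hle
    have : C.ncard = 0 ∨ C.ncard = 1 := by omega
    rcases this with h0 | h0 <;> simp [codeDim, h0] at h
  exact (Set.one_lt_ncard_iff_nontrivial_and_finite.1 h1).1

variable [CommRing R]

theorem minSumRankDist_le {c d : Fin L → Matrix (Fin m) (Fin n) R} (hc : c ∈ C) (hd : d ∈ C)
    (hcd : c ≠ d) : minSumRankDist C ≤ sumRankDist c d := Nat.sInf_le ⟨c, hc, d, hd, hcd, rfl⟩

theorem exists_sumRankDist_eq_minSumRankDist (hC : C.Nontrivial) :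
    ∃ c ∈ C, ∃ d ∈ C, c ≠ d ∧ sumRankDist c d = minSumRankDist C := by
  obtain ⟨c, hc, d, hd, hcd⟩ := hC
  exact Nat.sInf_mem (s := {w : ℕ | ∃ c ∈ C, ∃ d ∈ C, c ≠ d ∧ sumRankDist c d = w})
    ⟨_, c, hc, d, hd, hcd, rfl⟩

variable [IsPrincipalIdealRing R]

theorem minSumRankDist_transposeCode : minSumRankDist (transposeCode C) = minSumRankDist C := by
  have hdist : ∀ c d : Fin L → Matrix (Fin m) (Fin n) R,
      sumRankDist (fun l => (c l).transpose) (fun l => (d l).transpose) = sumRankDist c d := by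
    intro c d
    simp only [sumRankDist, sumRankWeight, Pi.sub_apply, ← Matrix.transpose_sub,
      smithRank_transpose]
  have hne : ∀ c d : Fin L → Matrix (Fin m) (Fin n) R,
      ((fun l => (c l).transpose) ≠ fun l => (d l).transpose) ↔ c ≠ d :=
    fun c d => transposeCode_injective.ne_iff
  simp only [minSumRankDist, transposeCode, Set.exists_mem_image, hdist, hne]

theorem minSumRankDist_pos (hC : C.Nontrivial) : 0 < minSumRankDist C := by
  obtain ⟨c, hc, d, hd, hcd, hdist⟩ := exists_sumRankDist_eq_minSumRankDist hC
  rw [← hdist, Nat.pos_iff_ne_zero]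
  intro h0
  rw [sumRankDist, sumRankWeight, Finset.sum_eq_zero_iff] at h0
  exact hcd (sub_eq_zero.1 (funext fun l =>
    eq_zero_of_smithRank_eq_zero (h0 l (Finset.mem_univ l))))

theorem minSumRankDist_le_mul (hC : C.Nontrivial) : minSumRankDist C ≤ L * n := by
  obtain ⟨c, hc, d, hd, hcd, hdist⟩ := exists_sumRankDist_eq_minSumRankDist hC
  rw [← hdist]
  refine (sumRankWeight_le_card_cols Finset.univ (by simp)).trans ?_
  simp

/-- Singleton bound: deleting any `d - 1` columns from the codewords of a code of minimum sum-rank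
distance `d` keeps them distinct. -/
theorem IsCodeOver.ncard_le_pow (hA : A.Finite) (hCA : IsCodeOver A C) (hC : C.Nontrivial) :
    C.ncard ≤ A.ncard ^ ((L * n - (minSumRankDist C - 1)) * m) := by
  classical
  obtain ⟨s, -, hs⟩ := Finset.exists_subset_card_eq
    (s := (Finset.univ : Finset (Fin L × Fin n))) (n := minSumRankDist C - 1) (by
      simpa using (Nat.sub_le _ 1).trans (minSumRankDist_le_mul hC))
  have := hA.to_subtype
  let g : C → ({p // p ∉ s} × Fin m → A) := fun c q =>
    ⟨c.1 q.1.1.1 q.2 q.1.1.2, hCA c.1 c.2 _ _ _⟩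
  have hg : Function.Injective g := by
    rintro ⟨c, hc⟩ ⟨d, hd⟩ hcd
    by_contra hne
    have hle := (minSumRankDist_le hc hd (by simpa using hne)).trans
      (sumRankWeight_le_card_cols s fun l i j hlj => by
        have := congrArg Subtype.val (congrFun hcd (⟨(l, j), hlj⟩, i))
        simpa [sub_eq_zero, g] using this)
    have := minSumRankDist_pos hC
    omega
  have hcard := Nat.card_le_card_of_injective g hg
  rw [Nat.card_fun, Nat.card_prod, Nat.card_coe_set_eq, Nat.card_coe_set_eq] at hcard
  convert hcard using 3
  · simp [Fintype.card_subtype_compl, hs]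
  · simp

theorem IsCodeOver.logb_ncard_le (hA : A.Finite) (hCA : IsCodeOver A C) (hC : C.Nontrivial) :
    Real.logb A.ncard C.ncard ≤ m * (L * n - minSumRankDist C + 1) := by
  have hq := hCA.one_lt_ncard hA hC
  have hC0 : 0 < C.ncard := (Set.ncard_pos (hCA.finite hA)).2 hC.nonempty
  have h1 := minSumRankDist_pos hC
  have h2 := minSumRankDist_le_mul hC
  have hexp : (((L * n - (minSumRankDist C - 1)) * m : ℕ) : ℝ) =
      m * (L * n - minSumRankDist C + 1) := by
    rw [Nat.cast_mul, Nat.cast_sub (by omega), Nat.cast_sub h1]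
    push_cast
    ring
  rw [Real.logb_le_iff_le_rpow (by exact_mod_cast hq) (by exact_mod_cast hC0), ← hexp,
    Real.rpow_natCast]
  exact_mod_cast hCA.ncard_le_pow hA hC

end

/-! ### Transfer of codes along a map of alphabets -/

section

variable {R K : Type*} {L m n : ℕ}
  {C : Set (Fin L → Matrix (Fin m) (Fin n) R)} {f : R → K}

theorem map_injective (hf : Function.Injective f) :
    Function.Injective fun (c : Fin L → Matrix (Fin m) (Fin n) R) l => (c l).map f :=
  fun _ _ h => funext fun l => Matrix.map_injective hf (congrFun h l)

theorem transposeCode_mapCode : transposeCode (mapCode f C) = mapCode f (transposeCode C) := by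
  simp only [transposeCode, mapCode, Set.image_image]
  rfl

theorem codeDim_mapCode (hf : Function.Injective f) :
    codeDim (Set.range f) (mapCode f C) = codeDim Set.univ C := by
  rw [codeDim, codeDim, mapCode, Set.ncard_image_of_injective _ (map_injective hf),
    ← Set.image_univ, Set.ncard_image_of_injective _ hf]

/-- A map of alphabets that does not decrease ranks of differences transfers maximum sum-rank
distance codes: the minimum distance cannot decrease, nor increase by the Singleton bound. -/
theorem IsMSRD.mapCode [CommRing R] [Finite R] [CommRing K]
    [IsPrincipalIdealRing K] (hf : Function.Injective f) (hm : 0 < m)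
    (hrank : ∀ A B : Matrix (Fin m) (Fin n) R, smithRank (A - B) ≤ smithRank (A.map f - B.map f))
    (hC : IsMSRD Set.univ C) :
    IsMSRD (Set.range f) (mapCode f C) ∧
      minSumRankDist (SumRank.mapCode f C) = minSumRankDist C := by
  obtain ⟨-, k, hk, hdim, hdist⟩ := hC
  have hCnt : C.Nontrivial := nontrivial_of_codeDim_pos (by rw [hdim]; exact_mod_cast hk)
  have hnt : (SumRank.mapCode f C).Nontrivial := hCnt.image (map_injective hf)
  have hover : IsCodeOver (Set.range f) (SumRank.mapCode f C) := by
    rintro _ ⟨c, -, rfl⟩ l i j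
    exact ⟨_, rfl⟩
  have hdim' : codeDim (Set.range f) (SumRank.mapCode f C) = k := by rw [codeDim_mapCode hf, hdim]
  have hge : minSumRankDist C ≤ minSumRankDist (SumRank.mapCode f C) := by
    obtain ⟨_, ⟨c, hc, rfl⟩, _, ⟨d, hd, rfl⟩, hne, heq⟩ := exists_sumRankDist_eq_minSumRankDist hnt
    rw [← heq]
    refine (minSumRankDist_le hc hd fun h => hne (by rw [h])).trans ?_
    simp only [sumRankDist, sumRankWeight, Pi.sub_apply]
    exact Finset.sum_le_sum fun l _ => hrank (c l) (d l)
  have hle : (minSumRankDist (SumRank.mapCode f C) : ℤ) ≤ L * n - k + 1 := by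
    have h := hover.logb_ncard_le (Set.finite_range f) hnt
    rw [logb_ncard_eq hm hdim'] at h
    have := le_of_mul_le_mul_left h (by exact_mod_cast hm)
    have h' : (k : ℤ) ≤ L * n - minSumRankDist (SumRank.mapCode f C) + 1 := by exact_mod_cast this
    omega
  have heq : minSumRankDist (SumRank.mapCode f C) = minSumRankDist C := by omega
  exact ⟨⟨hover, k, hk, hdim', by rw [heq, hdist]⟩, heq⟩

end

/-! ### Rate-diversity tradeoff -/

theorem diversity_eq_minSumRankDist {L nt T : ℕ} (X : Set (Fin L → Matrix (Fin nt) (Fin T) ℂ)) :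
    diversity X = minSumRankDist X := by
  simp only [diversity, minSumRankDist, sumRankDist, sumRankWeight, smithRank_eq_rank, Pi.sub_apply]

/-- If the Singleton bound `a (L b - d + 1)` for one choice of symbols is attained and the one for the
other choice holds, then the smaller of the two is attained. -/
theorem eq_max_mul_of_eq_of_le {a b L d x : ℝ} (hd : 1 ≤ d) (h : x = a * (L * b - d + 1))
    (h' : x ≤ b * (L * a - d + 1)) : x = max a b * (L * min a b - d + 1) := by
  rcases le_total b a with hab | hab
  · rw [max_eq_left hab, min_eq_right hab, h]
  · rw [max_eq_right hab, min_eq_left hab]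
    refine le_antisymm h' ?_
    rw [h]
    nlinarith [mul_nonneg (sub_nonneg.2 hab) (sub_nonneg.2 hd)]

section

variable {L nt T : ℕ} {A : Set ℂ} {X : Set (Fin L → Matrix (Fin nt) (Fin T) ℂ)}

theorem symbolRate_le_singletonRate (hA : A.Finite) (hXA : IsCodeOver A X) (hX : X.Nontrivial) :
    symbolRate A X ≤ singletonRate L nt T (diversity X) := by
  have h1 := hXA.logb_ncard_le hA hX
  have h2 := hXA.transposeCode.logb_ncard_le hA (nontrivial_transposeCode.2 hX)
  rw [ncard_transposeCode, minSumRankDist_transposeCode] at h2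
  rw [symbolRate, singletonRate, diversity_eq_minSumRankDist, one_div, div_eq_inv_mul]
  refine mul_le_mul_of_nonneg_left ?_ (by positivity)
  rcases le_total T nt with h | h
  · rwa [max_eq_left h, min_eq_right h]
  · rwa [max_eq_right h, min_eq_left h]

/-- A complex code of maximum sum-rank distance, with columns or rows as symbols, attains the
Singleton-type bound. If its own Singleton bound is the weaker of the two, the stronger one forces
the diversity to be `1`, where both bounds agree. -/
theorem isRateDiversityOptimal_of_isMSRD (hnt : 0 < nt) (hT : 0 < T) (hA : A.Finite)
    (h : IsMSRD A X ∨ IsMSRD A (transposeCode X)) : IsRateDiversityOptimal A X := by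
  obtain ⟨hXA, hX⟩ : IsCodeOver A X ∧ X.Nontrivial := by
    rcases h with ⟨hXA, k, hk, hdim, -⟩ | ⟨hXA, k, hk, hdim, -⟩
    · exact ⟨hXA, nontrivial_of_codeDim_pos (by rw [hdim]; exact_mod_cast hk)⟩
    · exact ⟨fun c hc l i j => hXA _ ⟨c, hc, rfl⟩ l j i, nontrivial_transposeCode.1
        (nontrivial_of_codeDim_pos (by rw [hdim]; exact_mod_cast hk))⟩
  refine ⟨hXA, hX, ?_, fun Y hYA hY => symbolRate_le_singletonRate hA hYA hY⟩
  have h1 := hXA.logb_ncard_le hA hX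
  have h2 := hXA.transposeCode.logb_ncard_le hA (nontrivial_transposeCode.2 hX)
  rw [ncard_transposeCode, minSumRankDist_transposeCode] at h2
  have hd : (1 : ℝ) ≤ minSumRankDist X := by exact_mod_cast minSumRankDist_pos hX
  rw [symbolRate, singletonRate, diversity_eq_minSumRankDist, one_div, div_eq_inv_mul,
    Nat.cast_max, Nat.cast_min]
  congr 1
  rcases h with ⟨-, k, -, hdim, hdist⟩ | ⟨-, k, -, hdim, hdist⟩
  · refine eq_max_mul_of_eq_of_le hd ?_ h2
    rw [logb_ncard_eq hnt hdim]
    have : (minSumRankDist X : ℝ) = L * T - k + 1 := by exact_mod_cast hdist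
    rw [this]; ring
  · rw [max_comm, min_comm]
    refine eq_max_mul_of_eq_of_le hd ?_ h1
    rw [← ncard_transposeCode, logb_ncard_eq hT hdim]
    rw [minSumRankDist_transposeCode] at hdist
    have : (minSumRankDist X : ℝ) = L * nt - k + 1 := by exact_mod_cast hdist
    rw [this]; ring

end

end SumRank

theorem mainTheorem11 {R Q : Type*} [CommRing R] [Finite R] [IsLocalRing R]
    (hchain : ∀ I J : Ideal R, I ≤ J ∨ J ≤ I)
    [CommRing Q] [IsPrincipalIdealRing Q]
    (φ : Q →+* R) (hφ : Function.Surjective φ)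
    (φs : R → Q) (hφs : ∀ r, φ (φs r) = r)
    {L nt T : ℕ} (hL : 0 < L) (hnt : 0 < nt) (hT : 0 < T)
    (C : Set (Fin L → Matrix (Fin nt) (Fin T) R)) :
    -- symbols are columns
    (SumRank.IsMSRD Set.univ C →
      SumRank.IsMSRD (Set.range φs) (SumRank.mapCode φs C) ∧
      SumRank.codeDim (Set.range φs) (SumRank.mapCode φs C) = SumRank.codeDim Set.univ C ∧
      SumRank.minSumRankDist (SumRank.mapCode φs C) = SumRank.minSumRankDist C) ∧
    -- symbols are rows
    (SumRank.IsMSRD Set.univ (SumRank.transposeCode C) →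
      SumRank.IsMSRD (Set.range φs) (SumRank.transposeCode (SumRank.mapCode φs C)) ∧
      SumRank.codeDim (Set.range φs) (SumRank.transposeCode (SumRank.mapCode φs C)) =
        SumRank.codeDim Set.univ (SumRank.transposeCode C) ∧
      SumRank.minSumRankDist (SumRank.mapCode φs C) = SumRank.minSumRankDist C) ∧
    -- complex constellations
    (SumRank.IsMSRD Set.univ C ∨ SumRank.IsMSRD Set.univ (SumRank.transposeCode C) →
      ∀ ι : Q →+* ℂ, Function.Injective ι →
        SumRank.IsRateDiversityOptimal (Set.range fun r => ι (φs r))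
          (SumRank.mapCode (fun r => ι (φs r)) C) ∧
        SumRank.diversity (SumRank.mapCode (fun r => ι (φs r)) C) =
          SumRank.minSumRankDist C) := by
  have hinj : Function.Injective φs := Function.LeftInverse.injective hφs
  have hmap : ∀ {m n : ℕ} (A B : Matrix (Fin m) (Fin n) R),
      (A.map φs - B.map φs).map φ = A - B := fun A B => by
    ext i j
    simp [hφs]
  have hrank : ∀ {m n : ℕ} (A B : Matrix (Fin m) (Fin n) R),
      SumRank.smithRank (A - B) ≤ SumRank.smithRank (A.map φs - B.map φs) := fun A B => by
    rw [← hmap A B]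
    exact SumRank.smithRank_map_le _ φ
  have : IsPrincipalIdealRing R := IsPrincipalIdealRing.of_surjective φ hφ
  refine ⟨fun hC => ?_, fun hC => ?_, fun hC ι hι => ?_⟩
  · obtain ⟨h1, h2⟩ := hC.mapCode hinj hnt hrank
    exact ⟨h1, SumRank.codeDim_mapCode hinj, h2⟩
  · obtain ⟨h1, h2⟩ := hC.mapCode hinj hT hrank
    rw [← SumRank.transposeCode_mapCode] at h1 h2
    rw [SumRank.minSumRankDist_transposeCode, SumRank.minSumRankDist_transposeCode] at h2
    refine ⟨h1, ?_, h2⟩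
    rw [SumRank.transposeCode_mapCode, SumRank.codeDim_mapCode hinj]
  · have hinj' : Function.Injective fun r => ι (φs r) := hι.comp hinj
    have hrank' : ∀ {m n : ℕ} (A B : Matrix (Fin m) (Fin n) R), SumRank.smithRank (A - B) ≤
        SumRank.smithRank (A.map (fun r => ι (φs r)) - B.map fun r => ι (φs r)) := fun A B => by
      have hι' : A.map (fun r => ι (φs r)) - B.map (fun r => ι (φs r)) =
          (A.map φs - B.map φs).map ι := by
        ext i j
        simp
      rw [hι']
      exact (hrank A B).trans (SumRank.smithRank_le_smithRank_map _ hι)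
    rw [SumRank.diversity_eq_minSumRankDist]
    have hA : (Set.range fun r => ι (φs r)).Finite := Set.finite_range _
    rcases hC with hC | hC
    · obtain ⟨h1, h2⟩ := hC.mapCode hinj' hnt hrank'
      exact ⟨SumRank.isRateDiversityOptimal_of_isMSRD hnt hT hA (.inl h1), h2⟩
    · obtain ⟨h1, h2⟩ := hC.mapCode hinj' hT hrank'
      rw [← SumRank.transposeCode_mapCode] at h1 h2
      rw [SumRank.minSumRankDist_transposeCode, SumRank.minSumRankDist_transposeCode] at h2
      exact ⟨SumRank.isRateDiversityOptimal_of_isMSRD hnt hT hA (.inr h1), h2⟩
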